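/- **Theorem.** Let $s\ge 2$ and let $X$ be a smooth manifold of dimension $2(s+1)$ with a rank two pointwise $s$-Kähler structure: a Riemannian metric $\mathbf g$ and smooth two-forms $\omega_{jk}$, $j,k\in\{0,\dots,s\}$, such that for every $p\in X$ there is an *adapted coframe* at $p$, that is, an orthonormal basis $\{v_{ij}\mid i=1,2,\ 0\le j\le s\}$ of $T^*_pX$ with $$\omega_{jk}(p)=v_{1j}\wedge v_{1k}+v_{2j}\wedge v_{2k}\qquad\text{for all } j,k .$$ (Every rank two almost $s$-Kähler manifold of dimension $2(s+1)$ is of this kind.) Fix $p\in X$ and an adapted coframe at $p$, and thereby the determination $Jv_{1j}=v_{2j}$, $Jv_{2j}=-v_{1j}$ of the complex structure at $p$. On $\bigwedge^*T^*_pX$ consider the operators $$L_{jk}(\phi)=\omega_{jk}(p)\wedge\phi\quad(j\ne k),\qquad V_j(\phi)=v_{1j}\wedge v_{2j}\wedge\phi ,$$ and their adjoints $\Lambda_{jk}=L_{jk}^*$, $A_j=V_j^*$ with respect to the metric on $\bigwedge^*T^*_pX$ induced by $\mathbf g$. Let $\mathcal L^s_{\mathbb R,p}$ be the real Lie algebra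 generated by all the $L_{jk},V_j,\Lambda_{jk},A_j$, let $\mathcal L^s_{\mathbb C,p}=\mathcal L^s_{\mathbb R,p}\otimes_{\mathbb R}\mathbb C$, regarded as a complex Lie algebra of operators on $\bigwedge^*_{\mathbb C}T^*_pX$, and let $\mathbf s\mathcal L^s_p$ be the real Lie algebra of operators on $\bigwedge^*_{\mathbb C}T^*_pX$ generated by all the $$L_{jk},\quad \imath V_j,\quad \Lambda_{jk},\quad \imath A_j .$$ Then $\mathbf s\mathcal L^s_p$ is a real form of $\mathcal L^s_{\mathbb C,p}$ (that is, $\mathcal L^s_{\mathbb C,p}=\mathbf s\mathcal L^s_p\oplus\imath\,\mathbf s\mathcal L^s_p$), and it is isomorphic, as a real Lie algebra, to $\mathbf{sl}(2s+2,\mathbb R)$. In other words, the bundle of real Lie algebras $\mathbf s\mathcal L^s$ on $X$ has fibre isomorphic to the split real form $\mathbf{sl}(2s+2,\mathbb R)$. -/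

import Mathlib

open scoped Manifold ContDiff TensorProduct

attribute [local instance 100] LieRing.ofAssociativeRing

noncomputable section

namespace SKahler

/-! ### Exterior algebra of an inner product space -/

section Exterior

variable {W : Type*} [AddCommGroup W] [Module ℝ W]

/-- The contraction action of `⋀ W` on itself determined by a bilinear form `b` on `W`: the
algebra homomorphism that sends `w` to the contraction (left interior product) with the
functional `b w`. -/
def contraction (b : LinearMap.BilinForm ℝ W) :
    ExteriorAlgebra ℝ W →ₐ[ℝ] Module.End ℝ (ExteriorAlgebra ℝ W) :=
  ExteriorAlgebra.lift ℝ
    ⟨(CliffordAlgebra.contractLeft (Q := (0 : QuadraticForm ℝ W))).comp b, fun w => by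
      refine LinearMap.ext fun x => ?_
      exact CliffordAlgebra.contractLeft_contractLeft (b w) x⟩

/-- The bilinear form on `⋀ W` induced by a bilinear form `b` on `W`. Different degrees are
orthogonal, and `(v₁ ∧ ⋯ ∧ vₖ, w₁ ∧ ⋯ ∧ wₖ) = det (b vᵢ wⱼ)`: this is the scalar part of the
contraction of the second argument by `v₁`, then by `v₂`, …, then by `vₖ`. -/
def extInner (b : LinearMap.BilinForm ℝ W) : LinearMap.BilinForm ℝ (ExteriorAlgebra ℝ W) :=
  LinearMap.mk₂ ℝ
    (fun x y => ExteriorAlgebra.algebraMapInv (contraction b (CliffordAlgebra.reverse x) y))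
    (fun x x' y => by simp) (fun c x y => by simp) (fun x y y' => by simp)
    (fun c x y => by simp)

/-- The wedge operator `x ↦ η ∧ x`. -/
def wedge (η : ExteriorAlgebra ℝ W) : Module.End ℝ (ExteriorAlgebra ℝ W) :=
  LinearMap.mulLeft ℝ η

/-- `T'` is the adjoint of `T` for the metric on `⋀ W` induced by `b`. -/
def IsAdjointOf (b : LinearMap.BilinForm ℝ W) (T' T : Module.End ℝ (ExteriorAlgebra ℝ W)) : Prop :=
  LinearMap.IsAdjointPair (extInner b) (extInner b) T T'

end Exterior

section Pointwise

variable {V : Type*} [AddCommGroup V] [Module ℝ V]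

/-- The value `η(y, z)` of an element `η` of `⋀² V*` on two vectors, with
`(φ ∧ ψ)(y, z) = φ(y) ψ(z) - φ(z) ψ(y)`. -/
def twoFormEval (η : ExteriorAlgebra ℝ (Module.Dual ℝ V)) : V →ₗ[ℝ] V →ₗ[ℝ] ℝ :=
  LinearMap.mk₂ ℝ
    (fun y z => ExteriorAlgebra.algebraMapInv
      (CliffordAlgebra.contractLeft (Q := (0 : QuadraticForm ℝ (Module.Dual ℝ V)))
        (Module.Dual.eval ℝ V z)
        (CliffordAlgebra.contractLeft (Q := (0 : QuadraticForm ℝ (Module.Dual ℝ V)))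
          (Module.Dual.eval ℝ V y) η)))
    (fun y y' z => by simp) (fun c y z => by simp) (fun y z z' => by simp)
    (fun c y z => by simp)

/-- The bilinear form on the dual space induced by a nondegenerate form `G`, through the
identification `♭ : V ≃ V*`, `x ↦ G x`. -/
def cometric [FiniteDimensional ℝ V] (G : LinearMap.BilinForm ℝ V) (hG : G.Nondegenerate) :
    LinearMap.BilinForm ℝ (Module.Dual ℝ V) :=
  G.compl₁₂ (G.toDual hG).symm.toLinearMap (G.toDual hG).symm.toLinearMap

end Pointwise

/-! ### Rank two pointwise `s`-Kähler manifolds -/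

/-- The model space, of dimension `2 (s + 1)`. -/
abbrev Model (s : ℕ) : Type := EuclideanSpace ℝ (Fin (2 * (s + 1)))

section Manifold

variable {s : ℕ} {X : Type*} [TopologicalSpace X] [ChartedSpace (Model s) X]

/-- The tangent space at `p`. -/
abbrev T (s : ℕ) {X : Type*} [TopologicalSpace X] [ChartedSpace (Model s) X] (p : X) : Type :=
  TangentSpace 𝓘(ℝ, Model s) p

instance (p : X) : FiniteDimensional ℝ (T s p) :=
  inferInstanceAs (FiniteDimensional ℝ (Model s))

instance (p : X) : T2Space (T s p) :=
  inferInstanceAs (T2Space (Model s))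

/-- The cotangent space at `p`. -/
abbrev CoT (s : ℕ) {X : Type*} [TopologicalSpace X] [ChartedSpace (Model s) X] (p : X) : Type :=
  Module.Dual ℝ (T s p)

/-- The real forms at `p`: `⋀* T*_p X`. -/
abbrev Forms (s : ℕ) {X : Type*} [TopologicalSpace X] [ChartedSpace (Model s) X] (p : X) : Type :=
  ExteriorAlgebra ℝ (CoT s p)

/-- The complex forms at `p`: `⋀*_ℂ T*_p X`, the complexification of `⋀* T*_p X`. -/
abbrev CForms (s : ℕ) {X : Type*} [TopologicalSpace X] [ChartedSpace (Model s) X] (p : X) : Type :=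
  ℂ ⊗[ℝ] Forms s p

variable [IsManifold 𝓘(ℝ, Model s) ∞ X]

/-- Smooth Riemannian metrics on `X`. -/
abbrev Metric (s : ℕ) (X : Type*) [TopologicalSpace X] [ChartedSpace (Model s) X]
    [IsManifold 𝓘(ℝ, Model s) ∞ X] :=
  Bundle.ContMDiffRiemannianMetric 𝓘(ℝ, Model s) ∞ (Model s)
    (fun p : X => TangentSpace 𝓘(ℝ, Model s) p)

/-- The metric at `p`, as a bilinear form on `T_p X`. -/
def Metric.form (g : Metric s X) (p : X) : LinearMap.BilinForm ℝ (T s p) :=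
  (g.inner p).toLinearMap₁₂

theorem Metric.form_nondegenerate (g : Metric s X) (p : X) : (g.form p).Nondegenerate := by
  have hs : ∀ x y, g.form p x y = g.form p y x := g.symm p
  have key : ∀ x, g.form p x x = 0 → x = 0 := fun x hx => by
    by_contra h
    exact (g.pos p x h).ne' hx
  exact ⟨fun x hx => key x (hx x), fun x hx => key x (hx x)⟩

/-- The metric induced by `g` on the cotangent space `T*_p X`. -/
def Metric.dual (g : Metric s X) (p : X) : LinearMap.BilinForm ℝ (CoT s p) :=
  cometric (g.form p) (g.form_nondegenerate p)

/-- Frames of `T*_p X`, written `v (i, j)` with `i ∈ {0, 1}` and `j ∈ {0, …, s}`. -/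
abbrev Coframe (s : ℕ) {X : Type*} [TopologicalSpace X] [ChartedSpace (Model s) X] (p : X) :
    Type :=
  Module.Basis (Fin 2 × Fin (s + 1)) ℝ (CoT s p)

/-- A coframe `v` at `p` is adapted to the metric `g` and the two-forms `form j k` at `p` if it is
orthonormal and `form j k = ∑ i, v (i, j) ∧ v (i, k)` for all `j, k`. -/
structure IsAdapted (g : Metric s X) (p : X) (form : Fin (s + 1) → Fin (s + 1) → Forms s p)
    (v : Coframe s p) : Prop where
  orthonormal : ∀ a b, g.dual p (v a) (v b) = if a = b then 1 else 0
  form_eq : ∀ j k, form j k =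
    ∑ i, ExteriorAlgebra.ι ℝ (v (i, j)) * ExteriorAlgebra.ι ℝ (v (i, k))

/-- A pointwise `s`-Kähler structure of rank two on a smooth manifold `X` of dimension
`2 (s + 1)`: a Riemannian metric and smooth two-forms `form j k`, `j, k ∈ {0, …, s}` (sections of
`⋀² T*X`), that admit an adapted coframe at every point. -/
structure Structure (s : ℕ) (X : Type*) [TopologicalSpace X] [ChartedSpace (Model s) X]
    [IsManifold 𝓘(ℝ, Model s) ∞ X] where
  metric : Metric s X
  form : Fin (s + 1) → Fin (s + 1) → ∀ p : X, ⋀[ℝ]^2 (CoT s p)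
  smooth : ∀ j k, ContMDiff 𝓘(ℝ, Model s)
    (𝓘(ℝ, Model s).prod 𝓘(ℝ, Model s →L[ℝ] Model s →L[ℝ] ℝ)) ∞
    (fun p : X => Bundle.TotalSpace.mk' (Model s →L[ℝ] Model s →L[ℝ] ℝ)
      (E := fun p : X => TangentSpace 𝓘(ℝ, Model s) p →L[ℝ]
        TangentSpace 𝓘(ℝ, Model s) p →L[ℝ] ℝ) p
      (twoFormEval (V := T s p) (form j k p : Forms s p)).toContinuousBilinearMap)
  exists_adapted : ∀ p, ∃ v : Coframe s p, IsAdapted metric p (fun j k => form j k p) v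

namespace Structure

variable (S : Structure s X)

/-- `v` is an adapted coframe at `p`. Such a coframe carries the determination
`J v₁ⱼ = v₂ⱼ`, `J v₂ⱼ = -v₁ⱼ` of the complex structure at `p`, and every determination of it
arises in this way. -/
def Adapted (p : X) (v : Coframe s p) : Prop :=
  IsAdapted S.metric p (fun j k => S.form j k p) v

/-- `L j k`: wedge with the form `form j k`. -/
def L (p : X) (j k : Fin (s + 1)) : Module.End ℝ (Forms s p) :=
  wedge (S.form j k p : Forms s p)

end Structure

/-- `V j`: wedge with `v₁ⱼ ∧ v₂ⱼ`, the volume form of the plane `W j = ⟨v₁ⱼ, v₂ⱼ⟩`, oriented by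
the determination of the complex structure that `v` carries. -/
def Vol {p : X} (v : Coframe s p) (j : Fin (s + 1)) : Module.End ℝ (Forms s p) :=
  wedge (ExteriorAlgebra.ι ℝ (v (0, j)) * ExteriorAlgebra.ι ℝ (v (1, j)))

namespace Structure

variable (S : Structure s X)

/-- The operators `L j k`, `j ≠ k`, and their adjoints `Λ j k`. -/
def lefschetz (p : X) : Set (Module.End ℝ (Forms s p)) :=
  {R | ∃ j k, j ≠ k ∧ (R = S.L p j k ∨ IsAdjointOf (S.metric.dual p) R (S.L p j k))}

/-- The operators `V j` and their adjoints `A j`. -/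
def volume (p : X) (v : Coframe s p) : Set (Module.End ℝ (Forms s p)) :=
  {R | ∃ j, R = Vol v j ∨ IsAdjointOf (S.metric.dual p) R (Vol v j)}

/-- The fibre at `p` of the bundle `𝓛_ℝ`: the real Lie algebra of operators on `⋀* T*_p X`
generated by the `L j k`, `V j` and their adjoints. -/
def LR (p : X) (v : Coframe s p) : LieSubalgebra ℝ (Module.End ℝ (Forms s p)) :=
  LieSubalgebra.lieSpan ℝ _ (S.lefschetz p ∪ S.volume p v)

/-- The fibre at `p` of the bundle `𝓛_ℂ`: the complexification of the fibre of `𝓛_ℝ`, realised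
by the `ℂ`-linear extensions of operators to complex forms. -/
def LC (p : X) (v : Coframe s p) : LieSubalgebra ℂ (Module.End ℂ (CForms s p)) :=
  LieSubalgebra.lieSpan ℂ _ {R | ∃ Q ∈ S.LR p v, R = Q.baseChange ℂ}

/-- The fibre at `p` of the bundle `s𝓛`: the real Lie algebra of operators on `⋀*_ℂ T*_p X`
generated by `L j k`, `i V j`, `Λ j k`, `i A j`. -/
def sL (p : X) (v : Coframe s p) : LieSubalgebra ℝ (Module.End ℂ (CForms s p)) :=
  LieSubalgebra.lieSpan ℝ _
    ({R | ∃ Q ∈ S.lefschetz p, R = Q.baseChange ℂ} ∪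
      {R | ∃ Q ∈ S.volume p v, R = Complex.I • Q.baseChange ℂ})

end Structure

end Manifold

/-- `𝔤` is a real form of `𝔥`: it spans `𝔥` over `ℂ`, and `𝔤 ∩ i𝔤 = 0`; that is,
`𝔥 = 𝔤 ⊕ i𝔤`. -/
def IsRealForm {A : Type*} [LieRing A] [LieAlgebra ℝ A] [LieAlgebra ℂ A]
    (𝔤 : LieSubalgebra ℝ A) (𝔥 : LieSubalgebra ℂ A) : Prop :=
  Submodule.span ℂ (𝔤 : Set A) = 𝔥.toSubmodule ∧
    ∀ x ∈ 𝔤, Complex.I • x ∈ 𝔤 → x = 0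

end SKahler

end

/-! Wedging with and contracting by the covectors of an adapted coframe give operators `E`, `N` that
satisfy the canonical anticommutation relations. Every generator is quadratic in them and commutes
with the rotations generated by J, so it is a combination of products of one operator of J-weight +1
and one of weight -1. A particle-hole exchange on the (0,1) part (`weightPlus`, `weightMinus`)
collects these into families x, y, indexed by two copies of {0,…,s}, that again satisfy the
anticommutation relations (`IsCAR.weight`).

For such families M ↦ ∑ Mₐᵦ xₐ yᵦ is an injective Lie homomorphism on square matrices
(`IsCAR.quantize`, `IsCAR.quantize_injective`), here of size 2s+2. Under it Lⱼₖ, Λⱼₖ, iVⱼ, iAⱼ are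
real multiples of real matrices: antisymmetric elementary matrices and diagonal units in the two
off-diagonal blocks. The factor i is exactly what makes the volume operators real. Once there are
three indices, these matrices generate all matrices of trace zero (`sl_sum_le`), so the real algebra
is sl(2s+2, ℝ).

Over ℂ the factor i is immaterial, so the same map carries sl(2s+2, ℂ) onto the complex algebra, and
the real form statement becomes sl(ℂ) = sl(ℝ) ⊕ i sl(ℝ). -/

noncomputable section

namespace SKahler

open Matrix

/-! ### Generators of the special linear algebra -/

section SpecialLinear

variable {K : Type*} [Field K] {ι : Type*} [Fintype ι] [DecidableEq ι]

/-- The matrices of trace zero are spanned, as a Lie algebra, by the off-diagonal matrix units. -/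
theorem sl_le_of_single_mem (H : LieSubalgebra K (Matrix ι ι K))
    (h : ∀ a b, a ≠ b → single a b (1 : K) ∈ H) : LieAlgebra.SpecialLinear.sl ι K ≤ H := by
  intro M hM
  have hM' : M.trace = 0 := by simpa [LieAlgebra.SpecialLinear.sl] using hM
  rcases isEmpty_or_nonempty ι with hι | ⟨⟨o⟩⟩
  · rw [Subsingleton.elim M 0]; exact H.zero_mem
  have hd : ∀ a, single a a (1 : K) - single o o 1 ∈ H := by
    intro a
    by_cases hao : a = o
    · subst hao; simp
    · have := H.lie_mem (h a o hao) (h o a (Ne.symm hao))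
      simpa [LieRing.of_associative_ring_bracket] using this
  -- The multiples of the unit at `o` that are subtracted add up to the trace of `M`, which is zero.
  have hMs : M = ∑ a, ∑ b, M a b • (single a b (1 : K) - if a = b then single o o 1 else 0) := by
    have h0 : ∑ a, ∑ b, M a b • (if a = b then single o o (1 : K) else 0) = 0 := by
      have : ∑ a, M a a • single o o (1 : K) = 0 := by
        rw [← Finset.sum_smul]
        have : ∑ a, M a a = 0 := hM'
        rw [this, zero_smul]
      simpa [smul_ite] using this
    simp only [smul_sub, Finset.sum_sub_distrib, h0, sub_zero]
    conv_lhs => rw [matrix_eq_sum_single M]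
    simp [smul_single]
  rw [hMs]
  refine sum_mem fun a _ => sum_mem fun b _ => H.smul_mem _ ?_
  by_cases hab : a = b
  · subst hab; simpa using hd a
  · simpa [hab] using h a b hab

/-- A Lie algebra of block matrices is everything of trace zero if it contains, in both
off-diagonal blocks, the diagonal matrix units and the elementary antisymmetric matrices. -/
theorem sl_sum_le {n : Type*} [Fintype n] [DecidableEq n] [NeZero (2 : K)]
    (hn : 2 < Fintype.card n) (H : LieSubalgebra K (Matrix (n ⊕ n) (n ⊕ n) K))
    (hu : ∀ j, single (Sum.inl j) (Sum.inr j) (1 : K) ∈ H)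
    (hl : ∀ j, single (Sum.inr j) (Sum.inl j) (1 : K) ∈ H)
    (hu' : ∀ j k, j ≠ k → single (Sum.inl j) (Sum.inr k) (1 : K) -
      single (Sum.inl k) (Sum.inr j) (1 : K) ∈ H)
    (hl' : ∀ j k, j ≠ k → single (Sum.inr j) (Sum.inl k) (1 : K) -
      single (Sum.inr k) (Sum.inl j) (1 : K) ∈ H) :
    LieAlgebra.SpecialLinear.sl (n ⊕ n) K ≤ H := by
  have hp : ∀ j k : n, j ≠ k → single (Sum.inl k) (Sum.inl j) (1 : K) +
      single (Sum.inr j) (Sum.inr k) (1 : K) ∈ H := by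
    intro j k hjk
    have := H.neg_mem (H.lie_mem (hu' j k hjk) (hl j))
    simpa [LieRing.of_associative_ring_bracket, sub_mul, mul_sub, hjk, hjk.symm, add_comm] using this
  -- Passing through a third index gives the combination with the opposite sign to `hp`; together
  -- they separate the two diagonal blocks. This is where more than two indices are needed.
  have hm : ∀ j l : n, j ≠ l → single (Sum.inl j) (Sum.inl l) (1 : K) -
      single (Sum.inr l) (Sum.inr j) (1 : K) ∈ H := by
    intro j l hjl
    obtain ⟨k, hkj, hkl⟩ : ∃ k, k ≠ j ∧ k ≠ l := by
      obtain ⟨k, hk⟩ : ∃ k, k ∉ ({j, l} : Finset n) := by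
        by_contra! hall
        have := Finset.card_le_card (fun x _ => hall x : Finset.univ ⊆ {j, l})
        have := Finset.card_le_two (a := j) (b := l)
        rw [Finset.card_univ] at *
        omega
      exact ⟨k, by simp_all, by simp_all⟩
    have := H.lie_mem (hu' j k hkj.symm) (hl' k l hkl)
    simpa [LieRing.of_associative_ring_bracket, sub_mul, mul_sub, hkj, hkl, hkj.symm, hkl.symm,
      hjl, hjl.symm] using this
  have hll : ∀ j l : n, j ≠ l → single (Sum.inl j) (Sum.inl l) (1 : K) ∈ H := by
    intro j l hjl
    have := H.smul_mem (2 : K)⁻¹ (H.add_mem (hp l j hjl.symm) (hm j l hjl))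
    rwa [add_add_sub_cancel, ← two_smul K, smul_smul, inv_mul_cancel₀ two_ne_zero, one_smul] at this
  have hrr : ∀ j l : n, j ≠ l → single (Sum.inr j) (Sum.inr l) (1 : K) ∈ H := by
    intro j l hjl
    simpa using H.sub_mem (hp j l hjl) (hll l j hjl.symm)
  have hlr : ∀ j l : n, single (Sum.inl j) (Sum.inr l) (1 : K) ∈ H := by
    intro j l
    by_cases hjl : j = l
    · subst hjl; exact hu j
    · simpa [LieRing.of_associative_ring_bracket] using H.lie_mem (hll j l hjl) (hu l)
  have hrl : ∀ j l : n, single (Sum.inr j) (Sum.inl l) (1 : K) ∈ H := by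
    intro j l
    by_cases hjl : j = l
    · subst hjl; exact hl j
    · simpa [LieRing.of_associative_ring_bracket] using H.lie_mem (hrr j l hjl) (hl l)
  refine sl_le_of_single_mem H ?_
  rintro (j | j) (l | l) hab
  · exact hll j l (by simpa using hab)
  · exact hlr j l
  · exact hrl j l
  · exact hrr j l (by simpa using hab)

end SpecialLinear

/-! ### Anticommutation relations and quantisation of matrices -/

section Quadratic

variable {ι A : Type*} [DecidableEq ι] [Ring A]

/-- The canonical anticommutation relations. -/
structure IsCAR (x y : ι → A) : Prop where
  xx : ∀ a b, x a * x b + x b * x a = 0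
  yy : ∀ a b, y a * y b + y b * y a = 0
  yx : ∀ a b, y a * x b + x b * y a = if a = b then 1 else 0

variable {x y : ι → A}

/-- Moving `x c` to the left past `y b` and `x a` changes sign twice, so only the contraction of `y
b` with `x c` survives: `x a * y b` acts on the span of the `x` as a matrix unit. -/
theorem IsCAR.lie_mul (h : IsCAR x y) (a b c : ι) :
    ⁅x a * y b, x c⁆ = if b = c then x a else 0 := by
  have h1 : y b * x c = (if b = c then 1 else 0) - x c * y b := eq_sub_of_add_eq (h.yx b c)
  have h2 : x a * x c = -(x c * x a) := eq_neg_of_add_eq_zero_left (h.xx a c)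
  rw [LieRing.of_associative_ring_bracket, mul_assoc, h1, mul_sub, ← mul_assoc, h2]
  split_ifs <;> noncomm_ring

theorem IsCAR.lie_mul' (h : IsCAR x y) (a b c : ι) :
    ⁅x a * y b, y c⁆ = if c = a then - y b else 0 := by
  have h1 : y c * x a = (if c = a then 1 else 0) - x a * y c := eq_sub_of_add_eq (h.yx c a)
  have h2 : y b * y c = -(y c * y b) := eq_neg_of_add_eq_zero_left (h.yy b c)
  rw [LieRing.of_associative_ring_bracket, mul_assoc, h2, ← mul_assoc, h1, sub_mul]
  split_ifs <;> noncomm_ring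

theorem IsCAR.lie_mul_mul (h : IsCAR x y) (a b c d : ι) :
    ⁅x a * y b, x c * y d⁆ =
      (if b = c then x a * y d else 0) - if d = a then x c * y b else 0 := by
  have : ⁅x a * y b, x c * y d⁆ = ⁅x a * y b, x c⁆ * y d + x c * ⁅x a * y b, y d⁆ := by
    simp only [LieRing.of_associative_ring_bracket]; noncomm_ring
  rw [this, h.lie_mul, h.lie_mul']
  split_ifs <;> simp [sub_eq_add_neg]

variable [Fintype ι]

section CommRing

variable (R : Type*) [CommRing R] [Algebra R A]

variable (x y) in
/-- The linear map `M ↦ ∑ Mₐᵦ xₐ yᵦ`. -/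
def quadratic : Matrix ι ι R →ₗ[R] A where
  toFun M := ∑ a, ∑ b, M a b • (x a * y b)
  map_add' M N := by simp [add_smul, Finset.sum_add_distrib]
  map_smul' c M := by simp [mul_smul, Finset.smul_sum]

omit [DecidableEq ι] in
theorem quadratic_apply (M : Matrix ι ι R) :
    quadratic x y R M = ∑ a, ∑ b, M a b • (x a * y b) := rfl

theorem quadratic_single (a b : ι) (c : R) :
    quadratic x y R (single a b c) = c • (x a * y b) := by
  rw [quadratic_apply, Finset.sum_eq_single a, Finset.sum_eq_single b]
  · simp
  · intro b' _ hb; simp [hb.symm]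
  · simp
  · intro a' _ ha; simp [ha.symm]
  · simp

theorem IsCAR.quadratic_lie (h : IsCAR x y) (M N : Matrix ι ι R) :
    quadratic x y R ⁅M, N⁆ = ⁅quadratic x y R M, quadratic x y R N⁆ := by
  induction M using Matrix.induction_on' with
  | h_zero => simp
  | h_add M M' ih ih' => rw [add_lie, map_add, map_add, add_lie, ih, ih']
  | h_std_basis a b r =>
    induction N using Matrix.induction_on' with
    | h_zero => simp
    | h_add N N' ih ih' => rw [lie_add, map_add, map_add, lie_add, ih, ih']
    | h_std_basis c d t =>
      have e : ⁅r • (x a * y b), t • (x c * y d)⁆ = (r * t) • ⁅x a * y b, x c * y d⁆ := by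
        simp only [LieRing.of_associative_ring_bracket, smul_mul_smul_comm, smul_sub, mul_comm t r]
      rw [quadratic_single, quadratic_single, e, h.lie_mul_mul,
        LieRing.of_associative_ring_bracket, map_sub, smul_sub]
      congr 1
      · by_cases hbc : b = c
        · subst hbc; simp [quadratic_single]
        · simp [hbc]
      · by_cases hda : d = a
        · subst hda; simp [quadratic_single, mul_comm t r]
        · simp [hda]

/-- The quantisation `M ↦ ∑ Mₐᵦ xₐ yᵦ` of matrices by operators that satisfy the canonical
anticommutation relations. -/
def IsCAR.quantize (h : IsCAR x y) : Matrix ι ι R →ₗ⁅R⁆ A where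
  __ := quadratic x y R
  map_lie' {M N} := h.quadratic_lie R M N

theorem IsCAR.quantize_apply (h : IsCAR x y) (M : Matrix ι ι R) :
    h.quantize R M = ∑ a, ∑ b, M a b • (x a * y b) := rfl

@[simp]
theorem IsCAR.quantize_single (h : IsCAR x y) (a b : ι) (c : R) :
    h.quantize R (single a b c) = c • (x a * y b) := quadratic_single R a b c

end CommRing

/-- The entries can be read off from the operator: bracketing with `x c` extracts column `c`, and
the anticommutator with `y d` then extracts the entry `M d c`. -/
theorem IsCAR.quantize_injective {F : Type*} [Field F] [Algebra F A] [Nontrivial A]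
    (h : IsCAR x y) : Function.Injective (h.quantize F) := by
  rw [injective_iff_map_eq_zero]
  intro M hM
  ext d c
  have h1 : ⁅h.quantize F M, x c⁆ = ∑ a, M a c • x a := by
    rw [h.quantize_apply F]
    simp only [LieRing.of_associative_ring_bracket, Finset.sum_mul, Finset.mul_sum]
    simp only [← Finset.sum_sub_distrib, smul_mul_assoc, mul_smul_comm, ← smul_sub,
      ← LieRing.of_associative_ring_bracket, h.lie_mul]
    simp
  have h2 : y d * ⁅h.quantize F M, x c⁆ + ⁅h.quantize F M, x c⁆ * y d = M d c • 1 := by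
    rw [h1, Finset.mul_sum, Finset.sum_mul, ← Finset.sum_add_distrib]
    simp only [smul_mul_assoc, mul_smul_comm, ← smul_add, h.yx]
    simp
  rw [hM] at h2
  simpa using h2.symm

end Quadratic
-- Contractions as adjoints on the exterior algebra
section Exterior

variable {W : Type*} [AddCommGroup W] [Module ℝ W] (b : LinearMap.BilinForm ℝ W)

theorem contraction_ι_mul (v w : W) (x : ExteriorAlgebra ℝ W) :
    contraction b (ExteriorAlgebra.ι ℝ v) (ExteriorAlgebra.ι ℝ w * x) =
      b v w • x - ExteriorAlgebra.ι ℝ w * contraction b (ExteriorAlgebra.ι ℝ v) x := by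
  simp only [contraction, ExteriorAlgebra.lift_ι_apply]
  exact CliffordAlgebra.contractLeft_ι_mul (Q := (0 : QuadraticForm ℝ W)) (b v) w x

theorem contraction_ι_one (v : W) :
    contraction b (ExteriorAlgebra.ι ℝ v) 1 = 0 := by
  simp only [contraction, ExteriorAlgebra.lift_ι_apply]
  exact CliffordAlgebra.contractLeft_one (Q := (0 : QuadraticForm ℝ W)) (b v)

theorem isAdjointOf_wedge_ι (v : W) :
    IsAdjointOf b (contraction b (ExteriorAlgebra.ι ℝ v)) (wedge (ExteriorAlgebra.ι ℝ v)) := by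
  intro x y
  -- Reversal puts `v` last in the product, so its contraction is the first to act on `y`.
  have : CliffordAlgebra.reverse (Q := (0 : QuadraticForm ℝ W)) (ExteriorAlgebra.ι ℝ v * x) =
    CliffordAlgebra.reverse (Q := (0 : QuadraticForm ℝ W)) x * ExteriorAlgebra.ι ℝ v := by
      erw [CliffordAlgebra.reverse.map_mul, CliffordAlgebra.reverse_ι]
  simp only [extInner, wedge, LinearMap.mk₂_apply, LinearMap.mulLeft_apply]
  erw [this]
  rw [map_mul]
  rfl

theorem IsAdjointOf.mul {S S' T T' : Module.End ℝ (ExteriorAlgebra ℝ W)}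
    (hS : IsAdjointOf b S' S) (hT : IsAdjointOf b T' T) : IsAdjointOf b (T' * S') (S * T) :=
  LinearMap.IsAdjointPair.mul hS hT

theorem IsAdjointOf.add {S S' T T' : Module.End ℝ (ExteriorAlgebra ℝ W)}
    (hS : IsAdjointOf b S' S) (hT : IsAdjointOf b T' T) : IsAdjointOf b (S' + T') (S + T) :=
  LinearMap.IsAdjointPair.add hS hT

variable {κ : Type*} [Fintype κ] [DecidableEq κ] (v : Module.Basis κ ℝ W)
  (hv : ∀ i j, b (v i) (v j) = if i = j then 1 else 0)
include hv

omit [Fintype κ] in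
theorem bilin_eq_repr (i : κ) (w : W) : b (v i) w = v.repr w i := by
  have : b (v i) = v.coord i := v.ext fun j => by
    rw [hv, v.coord_apply, v.repr_self, Finsupp.single_apply]
    simp [eq_comm]
  rw [this, v.coord_apply]

/-- Euler's formula: the number operator is the degree on homogeneous elements. -/
theorem sum_wedge_contraction (k : ℕ) (x : ExteriorAlgebra ℝ W) (hx : x ∈ ⋀[ℝ]^k W) :
    ∑ i, ExteriorAlgebra.ι ℝ (v i) * contraction b (ExteriorAlgebra.ι ℝ (v i)) x = (k : ℝ) • x := by
  induction hx using Submodule.pow_induction_on_left' with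
  | algebraMap r =>
    have : ∀ i, contraction b (ExteriorAlgebra.ι ℝ (v i)) (algebraMap ℝ _ r) = 0 := fun i => by
      rw [Algebra.algebraMap_eq_smul_one, map_smul, contraction_ι_one, smul_zero]
    simp [this]
  | add x y k hx hy ihx ihy =>
    simp only [map_add, mul_add, Finset.sum_add_distrib, ihx, ihy, smul_add]
  | mem_mul m hm k x hx ih =>
    obtain ⟨w, rfl⟩ := hm
    have h1 : ∑ i, b (v i) w • ExteriorAlgebra.ι ℝ (v i) = ExteriorAlgebra.ι ℝ w := by
      simp only [bilin_eq_repr b v hv]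
      conv_rhs => rw [← v.sum_repr w]
      simp only [map_sum, map_smul]
    -- The two signs cancel when `w` is pulled out, leaving degree `k` from `x`; the terms `b (v i)
    -- w` reassemble `w` and supply the extra one.
    have h2 : ∀ i, ExteriorAlgebra.ι ℝ (v i) * (ExteriorAlgebra.ι ℝ w *
        contraction b (ExteriorAlgebra.ι ℝ (v i)) x) = - (ExteriorAlgebra.ι ℝ w *
        (ExteriorAlgebra.ι ℝ (v i) * contraction b (ExteriorAlgebra.ι ℝ (v i)) x)) := fun i => by
      rw [← mul_assoc, ← mul_assoc, ← neg_mul]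
      congr 1
      exact eq_neg_of_add_eq_zero_left (ExteriorAlgebra.ι_add_mul_swap _ _)
    simp only [contraction_ι_mul, mul_sub, h2, mul_smul_comm, sub_neg_eq_add,
      Finset.sum_add_distrib, ← Finset.mul_sum, ih, ← smul_mul_assoc, ← Finset.sum_mul, h1]
    push_cast
    rw [add_smul, one_smul, add_comm, add_mul, smul_mul_assoc]

/-- Euler's formula multiplies the component of degree k by k. If all contractions vanish, so does
every component of positive degree. -/
theorem eq_algebraMap_of_contraction_eq_zero (x : ExteriorAlgebra ℝ W)
    (hx : ∀ i, contraction b (ExteriorAlgebra.ι ℝ (v i)) x = 0) :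
    x = algebraMap ℝ _ (ExteriorAlgebra.algebraMapInv x) := by
  classical
  have hdec : ∀ (z : ExteriorAlgebra ℝ W) (k : ℕ),
      (DirectSum.decompose (fun i : ℕ => ⋀[ℝ]^i W) (∑ i, ExteriorAlgebra.ι ℝ (v i) *
        contraction b (ExteriorAlgebra.ι ℝ (v i)) z) k : ExteriorAlgebra ℝ W) =
      (k : ℝ) • (DirectSum.decompose (fun i : ℕ => ⋀[ℝ]^i W) z k : ExteriorAlgebra ℝ W) := by
    intro z k
    induction z using DirectSum.Decomposition.inductionOn (fun i : ℕ => ⋀[ℝ]^i W) with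
    | zero => simp
    | @homogeneous j m =>
      rw [sum_wedge_contraction b v hv j m m.2, DirectSum.decompose_smul, DirectSum.decompose_coe]
      rw [DirectSum.smul_apply]
      by_cases hjk : j = k
      · subst hjk; simp
      · simp [DirectSum.of_eq_of_ne _ _ _ (Ne.symm hjk)]
    | add m m' h h' =>
      simp only [map_add, mul_add, Finset.sum_add_distrib, DirectSum.decompose_add,
        DirectSum.add_apply, Submodule.coe_add, h, h', smul_add]
  have h0 : ∀ k, k ≠ 0 →
      (DirectSum.decompose (fun i : ℕ => ⋀[ℝ]^i W) x k : ExteriorAlgebra ℝ W) = 0 := by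
    intro k hk
    have := hdec x k
    simp only [hx, mul_zero, Finset.sum_const_zero, DirectSum.decompose_zero,
      DirectSum.zero_apply, Submodule.coe_zero] at this
    simpa [hk] using this.symm
  have hx0 : x ∈ ⋀[ℝ]^0 W := by
    rw [← DirectSum.sum_support_decompose (fun i : ℕ => ⋀[ℝ]^i W) x]
    refine sum_mem fun k _ => ?_
    by_cases hk : k = 0
    · subst hk; exact SetLike.coe_mem _
    · rw [h0 k hk]; exact zero_mem _
  have hx1 : x ∈ (1 : Submodule ℝ (ExteriorAlgebra ℝ W)) := by
    rwa [← pow_zero (LinearMap.range (ExteriorAlgebra.ι ℝ (M := W)))]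
  obtain ⟨r, rfl⟩ := Submodule.mem_one.1 hx1
  simp

/-- The metric on `⋀ W` induced by a scalar product with an orthonormal basis is nondegenerate. -/
theorem extInner_separatingRight : (extInner b).SeparatingRight := by
  intro y hy
  have hy' : ∀ u, ExteriorAlgebra.algebraMapInv (contraction b u y) = 0 := fun u => by
    have := hy (CliffordAlgebra.reverse (Q := (0 : QuadraticForm ℝ W)) u)
    simp only [extInner, LinearMap.mk₂_apply] at this
    erw [CliffordAlgebra.reverse_reverse] at this
    exact this
  by_contra hne
  -- Contract a nonzero `y` by basis vectors as long as the result stays nonzero. Contractions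
  -- anticommute and square to zero, so those already exhausted stay so. At the end a nonzero scalar
  -- remains, against `hy'`.
  have key : ∀ F : Finset κ, ∃ u, contraction b u y ≠ 0 ∧
      ∀ i ∈ F, contraction b (ExteriorAlgebra.ι ℝ (v i)) (contraction b u y) = 0 := by
    intro F
    induction F using Finset.induction_on with
    | empty => exact ⟨1, by simpa using hne, by simp⟩
    | insert a F ha ih =>
      obtain ⟨u, hu, hF⟩ := ih
      by_cases h : contraction b (ExteriorAlgebra.ι ℝ (v a)) (contraction b u y) = 0
      · exact ⟨u, hu, by simpa [h] using hF⟩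
      · refine ⟨ExteriorAlgebra.ι ℝ (v a) * u, by simpa using h, fun i hi => ?_⟩
        have e : ExteriorAlgebra.ι ℝ (v i) * (ExteriorAlgebra.ι ℝ (v a) * u) =
          - (ExteriorAlgebra.ι ℝ (v a) * (ExteriorAlgebra.ι ℝ (v i) * u)) := by
            rw [← mul_assoc, ← mul_assoc, ← neg_mul]
            congr 1
            exact eq_neg_of_add_eq_zero_left (ExteriorAlgebra.ι_add_mul_swap _ _)
        rw [← Module.End.mul_apply, ← map_mul]
        rcases Finset.mem_insert.1 hi with rfl | hi
        · rw [← mul_assoc, ExteriorAlgebra.ι_sq_zero, zero_mul, map_zero, LinearMap.zero_apply]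
        · rw [e, map_neg, map_mul, map_mul, LinearMap.neg_apply, Module.End.mul_apply,
            Module.End.mul_apply, hF i hi, map_zero, neg_zero]
  obtain ⟨u, hu, hF⟩ := key Finset.univ
  refine hu ?_
  rw [eq_algebraMap_of_contraction_eq_zero b v hv _ fun i => hF i (Finset.mem_univ i), hy', map_zero]

/-- Adjoints enter the generators only through a relation; uniqueness identifies them with explicit
contractions. -/
theorem IsAdjointOf.unique {T R R' : Module.End ℝ (ExteriorAlgebra ℝ W)}
    (h : IsAdjointOf b R T) (h' : IsAdjointOf b R' T) : R = R' := by
  refine LinearMap.ext fun y => sub_eq_zero.1 (extInner_separatingRight b v hv _ fun x => ?_)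
  rw [map_sub, ← h x y, ← h' x y, sub_self]

theorem isAdjointOf_mul_iff {R : Module.End ℝ (ExteriorAlgebra ℝ W)} (i j : κ) :
    IsAdjointOf b R (wedge (ExteriorAlgebra.ι ℝ (v i)) * wedge (ExteriorAlgebra.ι ℝ (v j))) ↔
      R = contraction b (ExteriorAlgebra.ι ℝ (v j)) * contraction b (ExteriorAlgebra.ι ℝ (v i)) := by
  have hA := (isAdjointOf_wedge_ι b (v i)).mul b (isAdjointOf_wedge_ι b (v j))
  exact ⟨fun h => h.unique b v hv hA, fun h => h ▸ hA⟩

theorem isAdjointOf_add_iff {R : Module.End ℝ (ExteriorAlgebra ℝ W)} (i j k l : κ) :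
    IsAdjointOf b R (wedge (ExteriorAlgebra.ι ℝ (v i)) * wedge (ExteriorAlgebra.ι ℝ (v j)) +
      wedge (ExteriorAlgebra.ι ℝ (v k)) * wedge (ExteriorAlgebra.ι ℝ (v l))) ↔
      R = contraction b (ExteriorAlgebra.ι ℝ (v j)) * contraction b (ExteriorAlgebra.ι ℝ (v i)) +
        contraction b (ExteriorAlgebra.ι ℝ (v l)) *
          contraction b (ExteriorAlgebra.ι ℝ (v k)) := by
  have hA := ((isAdjointOf_wedge_ι b (v i)).mul b (isAdjointOf_wedge_ι b (v j))).add b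
    ((isAdjointOf_wedge_ι b (v k)).mul b (isAdjointOf_wedge_ι b (v l)))
  exact ⟨fun h => h.unique b v hv hA, fun h => h ▸ hA⟩

omit [Fintype κ] in
/-- Exterior and interior multiplication satisfy the canonical anticommutation relations. -/
theorem isCAR_wedge_contraction : IsCAR (fun i => wedge (ExteriorAlgebra.ι ℝ (v i)))
    (fun i => contraction b (ExteriorAlgebra.ι ℝ (v i))) where
  xx i j := by
    refine LinearMap.ext fun x => ?_
    simp only [wedge, LinearMap.add_apply, Module.End.mul_apply, LinearMap.mulLeft_apply,
      ← mul_assoc, ← add_mul, ExteriorAlgebra.ι_add_mul_swap, zero_mul, LinearMap.zero_apply]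
  yy i j := by rw [← map_mul (contraction b), ← map_mul (contraction b), ← map_add,
    ExteriorAlgebra.ι_add_mul_swap, map_zero]
  yx i j := by
    refine LinearMap.ext fun x => ?_
    simp only [wedge, LinearMap.add_apply, Module.End.mul_apply, LinearMap.mulLeft_apply,
      contraction_ι_mul, sub_add_cancel, hv]
    split_ifs <;> simp

end Exterior

theorem mem_sl_iff {ι R : Type*} [Fintype ι] [DecidableEq ι] [CommRing R] {M : Matrix ι ι R} :
    M ∈ LieAlgebra.SpecialLinear.sl ι R ↔ M.trace = 0 := Iff.rfl

theorem IsCAR.map {ι A B : Type*} [DecidableEq ι] [Ring A] [Ring B] {x y : ι → A}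
    (h : IsCAR x y) (f : A →+* B) : IsCAR (fun i => f (x i)) (fun i => f (y i)) where
  xx i j := by rw [← map_mul, ← map_mul, ← map_add, h.xx, map_zero]
  yy i j := by rw [← map_mul, ← map_mul, ← map_add, h.yy, map_zero]
  yx i j := by rw [← map_mul, ← map_mul, ← map_add, h.yx]; split_ifs <;> simp

/-! ### Real forms and operators of definite J-weight -/

section Complex

variable {A : Type*} [Ring A] [Algebra ℂ A] [Algebra ℝ A] [IsScalarTower ℝ ℂ A]

section RealForm

variable {ι : Type*} [Fintype ι] [DecidableEq ι] {x y : ι → A}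

theorem IsCAR.quantize_ofReal (h : IsCAR x y) (M : Matrix ι ι ℝ) :
    h.quantize ℂ (M.map Complex.ofReal) = h.quantize ℝ M := by
  simp only [IsCAR.quantize_apply, map_apply, ← Complex.coe_algebraMap, algebraMap_smul]

theorem IsCAR.quantize_eq_re_add_im (h : IsCAR x y) (M : Matrix ι ι ℂ) :
    h.quantize ℂ M = h.quantize ℝ (M.map Complex.re) +
      Complex.I • h.quantize ℝ (M.map Complex.im) := by
  rw [← h.quantize_ofReal, ← h.quantize_ofReal, ← map_smul, ← map_add]
  congr 1
  ext i j
  simp [mul_comm Complex.I, Complex.re_add_im]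

/-- Real and imaginary parts of a trace-zero matrix have trace zero, which gives the span.
Injectivity over ℂ reduces the trivial intersection to the fact that a real matrix equal to i times
a real matrix vanishes. -/
theorem IsCAR.isRealForm_quantize [Nontrivial A] (h : IsCAR x y) :
    IsRealForm ((LieAlgebra.SpecialLinear.sl ι ℝ).map (h.quantize ℝ))
      ((LieAlgebra.SpecialLinear.sl ι ℂ).map (h.quantize ℂ)) := by
  refine ⟨le_antisymm (Submodule.span_le.2 ?_) ?_, ?_⟩
  · rintro _ ⟨M, hM, rfl⟩
    refine ⟨M.map Complex.ofReal, ?_, h.quantize_ofReal M⟩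
    have hM' : M.trace = 0 := hM
    change (M.map Complex.ofReal).trace = 0
    simpa [trace] using congrArg Complex.ofReal hM'
  · rintro _ ⟨M, hM, rfl⟩
    have hM' : M.trace = 0 := hM
    have hre : (M.map Complex.re).trace = 0 := by
      simpa [trace] using congrArg Complex.re hM'
    have him : (M.map Complex.im).trace = 0 := by
      simpa [trace] using congrArg Complex.im hM'
    refine (h.quantize_eq_re_add_im M).symm ▸ Submodule.add_mem _ (Submodule.subset_span ?_)
      (Submodule.smul_mem _ _ (Submodule.subset_span ?_))
    · exact ⟨_, hre, rfl⟩
    · exact ⟨_, him, rfl⟩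
  · rintro _ ⟨M, hM, rfl⟩ ⟨N, hN, hMN⟩
    have e : h.quantize ℂ (N.map Complex.ofReal) =
        h.quantize ℂ (Complex.I • M.map Complex.ofReal) := by
      rw [map_smul, h.quantize_ofReal, h.quantize_ofReal]
      exact hMN
    have e' := h.quantize_injective e
    have : M = 0 := by
      ext i j
      simpa using (congrArg Complex.im (congrFun (congrFun e' i) j)).symm
    rw [this]
    exact map_zero (h.quantize ℝ)

omit [Algebra ℂ A] [IsScalarTower ℝ ℂ A] in
/-- Transport of `sl` along an injective quantisation and a bijection of the index sets. -/
theorem IsCAR.nonempty_equiv_sl [Nontrivial A] (h : IsCAR x y) {κ : Type*} [Fintype κ]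
    [DecidableEq κ] (e : ι ≃ κ) :
    Nonempty ((LieAlgebra.SpecialLinear.sl ι ℝ).map (h.quantize ℝ) ≃ₗ⁅ℝ⁆
      LieAlgebra.SpecialLinear.sl κ ℝ) := by
  have hr : ((h.quantize ℝ).comp (LieAlgebra.SpecialLinear.sl ι ℝ).incl).range =
      (LieAlgebra.SpecialLinear.sl ι ℝ).map (h.quantize ℝ) := by
    ext z
    simp [LieSubalgebra.mem_map]
  have hm : (LieAlgebra.SpecialLinear.sl ι ℝ).map (Matrix.reindexLieEquiv (R := ℝ) e).toLieHom =
      LieAlgebra.SpecialLinear.sl κ ℝ := by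
    have key : ∀ M : Matrix ι ι ℝ, (M.submatrix e.symm e.symm).trace = M.trace := fun M => by
      simp only [trace, diag_apply, submatrix_apply]
      exact e.symm.sum_comp fun i => M i i
    ext M
    constructor
    · rintro ⟨N, hN, rfl⟩
      exact (key N).trans hN
    · intro hM
      refine ⟨(Matrix.reindexLieEquiv (R := ℝ) e).symm M, ?_,
        (Matrix.reindexLieEquiv (R := ℝ) e).apply_symm_apply M⟩
      refine (key _).symm.trans (Eq.trans ?_ hM)
      congr 1
      exact (Matrix.reindexLieEquiv (R := ℝ) e).apply_symm_apply M
  rw [← hr]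
  exact ⟨(LieEquiv.ofInjective ((h.quantize ℝ).comp (LieAlgebra.SpecialLinear.sl ι ℝ).incl)
    ((h.quantize_injective (F := ℝ)).comp Subtype.val_injective)).symm.trans
    ((Matrix.reindexLieEquiv (R := ℝ) e).ofSubalgebras _ _ hm)⟩

end RealForm

section Hermitian

variable {n : Type*} [DecidableEq n] {E N : Fin 2 × n → A}

variable (E N) in
/-- The creation operators for the `(1, 0)`-forms and the annihilation operators for the
`(0, 1)`-forms. -/
def weightPlus : n ⊕ n → A
  | .inl j => E (0, j) + Complex.I • E (1, j)
  | .inr j => (1 / 2 : ℂ) • (N (0, j) + Complex.I • N (1, j))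

variable (E N) in
/-- The annihilation operators for the `(1, 0)`-forms and the creation operators for the
`(0, 1)`-forms. -/
def weightMinus : n ⊕ n → A
  | .inl j => (1 / 2 : ℂ) • (N (0, j) - Complex.I • N (1, j))
  | .inr j => E (0, j) - Complex.I • E (1, j)

omit [Algebra ℝ A] [IsScalarTower ℝ ℂ A] in
theorem add_smul_anticomm (a b c d : A) (r t : ℂ) :
    (a + r • b) * (c + t • d) + (c + t • d) * (a + r • b) =
      (a * c + c * a) + t • (a * d + d * a) + r • (b * c + c * b) +
        (r * t) • (b * d + d * b) := by
  simp only [add_mul, mul_add, smul_mul_assoc, mul_smul_comm, smul_smul, smul_add, mul_comm t r]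
  abel

omit [Algebra ℝ A] [IsScalarTower ℝ ℂ A] in
-- The only nonzero pairings are those of conjugate combinations at the same `j`; there the two
-- coframe directions contribute 1 each, and the factors 1/2 normalise the sum.
theorem IsCAR.weight (h : IsCAR E N) : IsCAR (weightPlus E N) (weightMinus E N) := by
  have hxy : ∀ a b, E a * N b + N b * E a = if b = a then 1 else 0 := fun a b => by
    rw [add_comm, h.yx]
  constructor
  · rintro (j | j) (k | k) <;>
      simp only [weightPlus, smul_mul_assoc, mul_smul_comm, smul_smul, ← smul_add,
        add_smul_anticomm, h.xx, h.yy, h.yx, hxy] <;>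
      simp [eq_comm] <;> split_ifs <;> simp
  · rintro (j | j) (k | k) <;>
      simp only [weightMinus, sub_eq_add_neg, ← neg_smul, smul_mul_assoc, mul_smul_comm, smul_smul,
        ← smul_add, add_smul_anticomm, h.xx, h.yy, h.yx, hxy] <;>
      simp [eq_comm] <;> split_ifs <;> simp
  · rintro (j | j) (k | k) <;>
      simp only [weightPlus, weightMinus, sub_eq_add_neg, ← neg_smul, smul_mul_assoc,
        mul_smul_comm, smul_smul, ← smul_add, add_smul_anticomm, h.xx, h.yy, h.yx, hxy] <;>
      simp [eq_comm] <;> split_ifs <;> simp [← two_smul ℂ, smul_smul]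

end Hermitian

end Complex

/-! ### The generators as real matrices -/

section SplitForm

variable {A : Type*} [Ring A] [Algebra ℂ A] [Algebra ℝ A] [IsScalarTower ℝ ℂ A]
variable {n : Type*} [Fintype n] [DecidableEq n] {E N : Fin 2 × n → A}

/-- Since (E₀ + iE₁)(E₀ - iE₁) = -2i E₀E₁, the factor i on the left makes the coefficient real. -/
theorem IsCAR.quantize_weight_upper_diag (h : IsCAR E N) (j : n) :
    Complex.I • (E (0, j) * E (1, j)) =
      (-1 / 2 : ℝ) • h.weight.quantize ℝ (single (.inl j) (.inr j) 1) := by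
  have h0 : E (0, j) * E (0, j) = 0 := by
    simpa [← two_smul ℂ] using h.xx (0, j) (0, j)
  have h1 : E (1, j) * E (1, j) = 0 := by
    simpa [← two_smul ℂ] using h.xx (1, j) (1, j)
  have h2 : E (1, j) * E (0, j) = - (E (0, j) * E (1, j)) :=
    eq_neg_of_add_eq_zero_left (h.xx _ _)
  rw [h.weight.quantize_single ℝ, one_smul, ← algebraMap_smul ℂ]
  simp only [weightPlus, weightMinus, mul_sub, add_mul, smul_mul_assoc, mul_smul_comm, h0, h1, h2]
  match_scalars
  norm_num
  ring

theorem IsCAR.quantize_weight_lower_diag (h : IsCAR E N) (j : n) :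
    Complex.I • (N (1, j) * N (0, j)) =
      (2 : ℝ) • h.weight.quantize ℝ (single (.inr j) (.inl j) 1) := by
  have h0 : N (0, j) * N (0, j) = 0 := by
    simpa [← two_smul ℂ] using h.yy (0, j) (0, j)
  have h1 : N (1, j) * N (1, j) = 0 := by
    simpa [← two_smul ℂ] using h.yy (1, j) (1, j)
  have h2 : N (0, j) * N (1, j) = - (N (1, j) * N (0, j)) :=
    eq_neg_of_add_eq_zero_left (h.yy _ _)
  rw [h.weight.quantize_single ℝ, one_smul, ← algebraMap_smul ℂ]
  simp only [weightPlus, weightMinus, mul_sub, add_mul, smul_mul_assoc, mul_smul_comm, h0, h1, h2]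
  match_scalars
  norm_num
  ring

/-- Antisymmetrising in `j`, `k` cancels the imaginary cross terms and doubles the real ones. -/
theorem IsCAR.quantize_weight_upper (h : IsCAR E N) (j k : n) :
    E (0, j) * E (0, k) + E (1, j) * E (1, k) =
      (1 / 2 : ℝ) • h.weight.quantize ℝ (single (.inl j) (.inr k) 1 -
        single (.inl k) (.inr j) 1) := by
  have h2 : ∀ a b, E (a, k) * E (b, j) = - (E (b, j) * E (a, k)) := fun a b =>
    eq_neg_of_add_eq_zero_left (h.xx _ _)
  rw [map_sub, h.weight.quantize_single ℝ, h.weight.quantize_single ℝ, one_smul, one_smul,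
    ← algebraMap_smul ℂ]
  simp only [weightPlus, weightMinus, mul_sub, add_mul, smul_mul_assoc, mul_smul_comm, h2]
  match_scalars <;> norm_num

theorem IsCAR.quantize_weight_lower (h : IsCAR E N) (j k : n) :
    N (0, k) * N (0, j) + N (1, k) * N (1, j) =
      (-2 : ℝ) • h.weight.quantize ℝ (single (.inr j) (.inl k) 1 -
        single (.inr k) (.inl j) 1) := by
  have h2 : ∀ a b, N (a, j) * N (b, k) = - (N (b, k) * N (a, j)) := fun a b =>
    eq_neg_of_add_eq_zero_left (h.yy _ _)
  rw [map_sub, h.weight.quantize_single ℝ, h.weight.quantize_single ℝ, one_smul, one_smul,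
    ← algebraMap_smul ℂ]
  simp only [weightPlus, weightMinus, mul_sub, add_mul, smul_mul_assoc, mul_smul_comm, h2]
  match_scalars <;> norm_num <;> ring_nf
  norm_num

variable (E N) in
/-- The generators `Lⱼₖ`, `Λⱼₖ`, `i Vⱼ`, `i Aⱼ`, in terms of creation and annihilation
operators. -/
def splitGenerators : Set A :=
  {R | ∃ j k, j ≠ k ∧ (R = E (0, j) * E (0, k) + E (1, j) * E (1, k) ∨
    R = N (0, k) * N (0, j) + N (1, k) * N (1, j))} ∪
  {R | ∃ j, R = Complex.I • (E (0, j) * E (1, j)) ∨ R = Complex.I • (N (1, j) * N (0, j))}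

theorem IsCAR.lieSpan_splitGenerators (h : IsCAR E N) (hn : 2 < Fintype.card n) :
    LieSubalgebra.lieSpan ℝ A (splitGenerators E N) =
      (LieAlgebra.SpecialLinear.sl (n ⊕ n) ℝ).map (h.weight.quantize ℝ) := by
  have hs : ∀ a b : n ⊕ n, a ≠ b → single a b (1 : ℝ) ∈ LieAlgebra.SpecialLinear.sl (n ⊕ n) ℝ :=
    fun a b hab => mem_sl_iff.2 (trace_single_eq_of_ne a b _ hab)
  have hm : ∀ {M : Matrix (n ⊕ n) (n ⊕ n) ℝ} (c : ℝ), M ∈ LieAlgebra.SpecialLinear.sl (n ⊕ n) ℝ →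
      c • h.weight.quantize ℝ M ∈
        (LieAlgebra.SpecialLinear.sl (n ⊕ n) ℝ).map (h.weight.quantize ℝ) :=
    fun c hM => LieSubalgebra.smul_mem _ c ⟨_, hM, rfl⟩
  -- Each generator is a nonzero real multiple of a quantised matrix, so dividing by it puts that
  -- matrix into the pullback of the generated algebra.
  have hc : ∀ {M : Matrix (n ⊕ n) (n ⊕ n) ℝ} {R : A} (c : ℝ), c ≠ 0 → R ∈ splitGenerators E N →
      R = c • h.weight.quantize ℝ M →
        M ∈ (LieSubalgebra.lieSpan ℝ A (splitGenerators E N)).comap (h.weight.quantize ℝ) := by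
    intro M R c hc hR hRM
    have := LieSubalgebra.smul_mem _ c⁻¹ (LieSubalgebra.subset_lieSpan (R := ℝ) hR)
    rw [hRM, smul_smul, inv_mul_cancel₀ hc, one_smul] at this
    exact this
  apply le_antisymm
  · rw [LieSubalgebra.lieSpan_le]
    rintro R (⟨j, k, hjk, rfl | rfl⟩ | ⟨j, rfl | rfl⟩)
    · rw [h.quantize_weight_upper]
      exact hm _ (sub_mem (hs _ _ (by simp)) (hs _ _ (by simp)))
    · rw [h.quantize_weight_lower]
      exact hm _ (sub_mem (hs _ _ (by simp)) (hs _ _ (by simp)))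
    · rw [h.quantize_weight_upper_diag]
      exact hm _ (hs _ _ (by simp))
    · rw [h.quantize_weight_lower_diag]
      exact hm _ (hs _ _ (by simp))
  · have key := sl_sum_le hn
      ((LieSubalgebra.lieSpan ℝ A (splitGenerators E N)).comap (h.weight.quantize ℝ))
      (fun j => hc _ (by norm_num) (.inr ⟨j, .inl rfl⟩) (h.quantize_weight_upper_diag j))
      (fun j => hc _ (by norm_num) (.inr ⟨j, .inr rfl⟩) (h.quantize_weight_lower_diag j))
      (fun j k hjk => hc _ (by norm_num) (.inl ⟨j, k, hjk, .inl rfl⟩)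
        (h.quantize_weight_upper j k))
      (fun j k hjk => hc _ (by norm_num) (.inl ⟨j, k, hjk, .inr rfl⟩)
        (h.quantize_weight_lower j k))
    rintro _ ⟨M, hM, rfl⟩
    exact key hM

end SplitForm

theorem mem_of_I_smul_mem {L : Type*} [LieRing L] [LieAlgebra ℂ L] {H : LieSubalgebra ℂ L}
    {x : L} (hx : Complex.I • x ∈ H) : x ∈ H := by
  have := H.smul_mem (-Complex.I) hx
  rwa [smul_smul, neg_mul, Complex.I_mul_I, neg_neg, one_smul] at this

theorem baseChange_lie {M : Type*} [AddCommGroup M] [Module ℝ M] (f g : Module.End ℝ M) :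
    (⁅f, g⁆ : Module.End ℝ M).baseChange ℂ =
      (⁅f.baseChange ℂ, g.baseChange ℂ⁆ : Module.End ℂ (ℂ ⊗[ℝ] M)) := by
  rw [LieRing.of_associative_ring_bracket, LieRing.of_associative_ring_bracket,
    LinearMap.baseChange_sub, LinearMap.baseChange_mul, LinearMap.baseChange_mul]

/-! ### The Lie algebras in a fibre -/

section Fibre

variable {s : ℕ} {X : Type*} [TopologicalSpace X] [ChartedSpace (Model s) X]
  [IsManifold 𝓘(ℝ, Model s) ∞ X]

/-- Complexified exterior multiplication by a vector of a coframe. -/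
def creation {p : X} (v : Coframe s p) (a : Fin 2 × Fin (s + 1)) : Module.End ℂ (CForms s p) :=
  (wedge (ExteriorAlgebra.ι ℝ (v a))).baseChange ℂ

/-- Complexified contraction with a vector of a coframe. -/
def annihilation (g : Metric s X) {p : X} (v : Coframe s p) (a : Fin 2 × Fin (s + 1)) :
    Module.End ℂ (CForms s p) :=
  (contraction (g.dual p) (ExteriorAlgebra.ι ℝ (v a))).baseChange ℂ

theorem wedge_mul {W : Type*} [AddCommGroup W] [Module ℝ W] (η θ : ExteriorAlgebra ℝ W) :
    wedge (η * θ) = wedge η * wedge θ :=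
  LinearMap.mulLeft_mul ℝ _ η θ

theorem wedge_add {W : Type*} [AddCommGroup W] [Module ℝ W] (η θ : ExteriorAlgebra ℝ W) :
    wedge (η + θ) = wedge η + wedge θ :=
  LinearMap.ext fun x => add_mul η θ x

instance (p : X) : Nontrivial (CForms s p) :=
  Module.FaithfullyFlat.lTensor_nontrivial ℝ ℂ (Forms s p)

namespace Structure

variable {S : Structure s X} {p : X} {v : Coframe s p}

theorem Adapted.isCAR (hv : S.Adapted p v) : IsCAR (creation v) (annihilation S.metric v) :=
  (isCAR_wedge_contraction (S.metric.dual p) v hv.orthonormal).map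
    (Module.End.baseChangeHom ℝ ℂ (Forms s p)).toRingHom

theorem Adapted.mem_lefschetz (hv : S.Adapted p v) (R : Module.End ℝ (Forms s p)) :
    R ∈ S.lefschetz p ↔ ∃ j k, j ≠ k ∧
      (R = wedge (ExteriorAlgebra.ι ℝ (v (0, j))) * wedge (ExteriorAlgebra.ι ℝ (v (0, k))) +
        wedge (ExteriorAlgebra.ι ℝ (v (1, j))) * wedge (ExteriorAlgebra.ι ℝ (v (1, k))) ∨
      R = contraction (S.metric.dual p) (ExteriorAlgebra.ι ℝ (v (0, k))) *
          contraction (S.metric.dual p) (ExteriorAlgebra.ι ℝ (v (0, j))) +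
        contraction (S.metric.dual p) (ExteriorAlgebra.ι ℝ (v (1, k))) *
          contraction (S.metric.dual p) (ExteriorAlgebra.ι ℝ (v (1, j)))) := by
  refine exists_congr fun j => exists_congr fun k => and_congr_right fun _ => ?_
  have hL : S.L p j k =
      wedge (ExteriorAlgebra.ι ℝ (v (0, j))) * wedge (ExteriorAlgebra.ι ℝ (v (0, k))) +
        wedge (ExteriorAlgebra.ι ℝ (v (1, j))) * wedge (ExteriorAlgebra.ι ℝ (v (1, k))) := by
    have := hv.form_eq j k
    rw [L, this, Fin.sum_univ_two, wedge_add, wedge_mul, wedge_mul]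
  rw [hL, isAdjointOf_add_iff _ v hv.orthonormal]

theorem Adapted.mem_volume (hv : S.Adapted p v) (R : Module.End ℝ (Forms s p)) :
    R ∈ S.volume p v ↔ ∃ j,
      (R = wedge (ExteriorAlgebra.ι ℝ (v (0, j))) * wedge (ExteriorAlgebra.ι ℝ (v (1, j))) ∨
      R = contraction (S.metric.dual p) (ExteriorAlgebra.ι ℝ (v (1, j))) *
          contraction (S.metric.dual p) (ExteriorAlgebra.ι ℝ (v (0, j)))) := by
  refine exists_congr fun j => ?_
  rw [Vol, wedge_mul, isAdjointOf_mul_iff _ v hv.orthonormal]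

theorem Adapted.sL_eq (hv : S.Adapted p v) : S.sL p v =
    LieSubalgebra.lieSpan ℝ _ (splitGenerators (creation v) (annihilation S.metric v)) := by
  rw [sL]
  congr 1
  simp only [splitGenerators, creation, annihilation, ← LinearMap.baseChange_mul,
    ← LinearMap.baseChange_add, hv.mem_lefschetz, hv.mem_volume]
  congr 1
  · ext R
    constructor
    · rintro ⟨_, ⟨j, k, hjk, rfl | rfl⟩, rfl⟩
      exacts [⟨j, k, hjk, .inl rfl⟩, ⟨j, k, hjk, .inr rfl⟩]
    · rintro ⟨j, k, hjk, rfl | rfl⟩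
      exacts [⟨_, ⟨j, k, hjk, .inl rfl⟩, rfl⟩, ⟨_, ⟨j, k, hjk, .inr rfl⟩, rfl⟩]
  · ext R
    constructor
    · rintro ⟨_, ⟨j, rfl | rfl⟩, rfl⟩
      exacts [⟨j, .inl rfl⟩, ⟨j, .inr rfl⟩]
    · rintro ⟨j, rfl | rfl⟩
      exacts [⟨_, ⟨j, .inl rfl⟩, rfl⟩, ⟨_, ⟨j, .inr rfl⟩, rfl⟩]

theorem sL_subset_LC : (S.sL p v : Set (Module.End ℂ (CForms s p))) ⊆ S.LC p v := by
  have hLR : ∀ Q ∈ S.lefschetz p ∪ S.volume p v, Q.baseChange ℂ ∈ S.LC p v := fun Q hQ =>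
    LieSubalgebra.subset_lieSpan ⟨Q, LieSubalgebra.subset_lieSpan hQ, rfl⟩
  intro R hR
  induction hR using LieSubalgebra.lieSpan_induction with
  | mem R hR =>
    rcases hR with ⟨Q, hQ, rfl⟩ | ⟨Q, hQ, rfl⟩
    · exact hLR Q (.inl hQ)
    · exact (S.LC p v).smul_mem _ (hLR Q (.inr hQ))
  | zero => exact (S.LC p v).zero_mem
  | add _ _ _ _ h h' => exact (S.LC p v).add_mem h h'
  | smul c R _ h =>
    rw [← algebraMap_smul ℂ c R]
    exact (S.LC p v).smul_mem _ h
  | lie _ _ _ _ h h' => exact (S.LC p v).lie_mem h h'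

/-- A complex Lie algebra of operators that contains `s𝓛` contains `𝓛_ℂ`. -/
theorem LC_le {H : LieSubalgebra ℂ (Module.End ℂ (CForms s p))}
    (hH : (S.sL p v : Set (Module.End ℂ (CForms s p))) ⊆ H) : S.LC p v ≤ H := by
  rw [LC, LieSubalgebra.lieSpan_le]
  rintro _ ⟨Q, hQ, rfl⟩
  induction hQ using LieSubalgebra.lieSpan_induction with
  | mem Q hQ =>
    rcases hQ with hQ | hQ
    · exact hH (LieSubalgebra.subset_lieSpan (.inl ⟨Q, hQ, rfl⟩))
    · exact mem_of_I_smul_mem (hH (LieSubalgebra.subset_lieSpan (.inr ⟨Q, hQ, rfl⟩)))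
  | zero => simp
  | add _ _ _ _ h h' => rw [LinearMap.baseChange_add]; exact H.add_mem h h'
  | smul c Q _ h =>
    rw [LinearMap.baseChange_smul, ← algebraMap_smul ℂ c (Q.baseChange ℂ)]
    exact H.smul_mem _ h
  | lie Q Q' _ _ h h' =>
    rw [baseChange_lie]
    exact H.lie_mem h h'

end Structure

end Fibre

end SKahler
end

theorem mainTheorem3 (s : ℕ) (hs : 2 ≤ s) (X : Type*) [TopologicalSpace X]
    [ChartedSpace (SKahler.Model s) X] [IsManifold 𝓘(ℝ, SKahler.Model s) ∞ X]
    (S : SKahler.Structure s X) (p : X) (v : SKahler.Coframe s p) (hv : S.Adapted p v) :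
    SKahler.IsRealForm (S.sL p v) (S.LC p v) ∧
      Nonempty (S.sL p v ≃ₗ⁅ℝ⁆ LieAlgebra.SpecialLinear.sl (Fin (2 * s + 2)) ℝ) := by
  -- The assumption `2 ≤ s` enters here, as `2 < s + 1`.
  have hsL := hv.sL_eq.trans (hv.isCAR.lieSpan_splitGenerators (by simp; omega))
  have hform := hv.isCAR.weight.isRealForm_quantize
  -- The quantised complex algebra is the ℂ-span of `sL`, and `LC` is the smallest complex Lie
  -- algebra containing `sL`, so the two agree.
  have hLC : S.LC p v =
      (LieAlgebra.SpecialLinear.sl _ ℂ).map (hv.isCAR.weight.quantize ℂ) := by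
    refine le_antisymm (SKahler.Structure.LC_le fun R hR => ?_) ?_
    · rw [hsL] at hR
      exact hform.1.le (Submodule.subset_span hR)
    · rw [← LieSubalgebra.toSubmodule_le_toSubmodule, ← hform.1, Submodule.span_le, ← hsL]
      exact SKahler.Structure.sL_subset_LC
  rw [hLC, hsL]
  exact ⟨hform, hv.isCAR.weight.nonempty_equiv_sl
    (finSumFinEquiv.trans (finCongr (by omega)))⟩
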